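/- Let $\mu$ be the unique Borel probability measure on $\mathbb{R}$ with $\mu(E)=\frac12\left(\mu(\tau_0^{-1}E)+\mu(\tau_2^{-1}E)\right)$ for all Borel sets $E\subset\mathbb{R}$, where $\tau_0(x)=\frac x4$ and $\tau_2(x)=\frac{x+2}4$. An odd natural number $m$ is called complete if the exponential functions $e_\lambda(x)=e^{2\pi i\lambda x}$, $\lambda\in\Gamma(m):=\left\{\sum_{k=0}^n4^kl_k : l_k\in\{0,m\},\ n\in\mathbb{N}\right\}$, form an orthonormal basis of $L^2(\mu)$. For an odd natural number $m$, let $o_4(m)$ be the smallest positive integer $a$ with $4^a\equiv1\pmod m$. A prime $p\geq3$ is called simple if $o_4(p)<o_4(p^2)$. Let $p_1,\dots,p_r$ be distinct simple prime numbers strictly larger than $3$. Assume that the following conditions are satisfied: (i) for every proper subset $F\subset\{1,\dots,r\}$ and all $k_i\geq0$, $i\in F$, the number $\prod_{i\in F}p_i^{k_i}$ is complete; (ii) none of the numbers $o_4(p_1),\dots,o_4(p_r)$ is divisible by any of the numbers $p_1,\dots,p_r$; (iii) $\operatorname{lcm}(o_4(p_1),\dots,o_4(p_r))>2^{\left\lceil\log_2\sqrt{\frac{p_1\cdots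 p_r}{3}}\right\rceil}$. Then $p_1^{k_1}\cdots p_r^{k_r}$ is complete for all integers $k_1,\dots,k_r\geq0$. -/

import Mathlib

open MeasureTheory

noncomputable section

namespace JPCantor

/-- The contraction `τ_d(x) = (x + d) / 4`. -/
def tau (d x : ℝ) : ℝ := (x + d) / 4

/-- The invariance equation `μ(E) = (μ(τ₀⁻¹ E) + μ(τ₂⁻¹ E)) / 2` for all Borel sets `E`. -/
def IsInvariant (μ : Measure ℝ) : Prop :=
  ∀ E : Set ℝ, MeasurableSet E → μ E = (1 / 2) * (μ (tau 0 ⁻¹' E) + μ (tau 2 ⁻¹' E))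

/-- The fair coin. -/
def coin : Measure Bool := (PMF.uniformOfFintype Bool).toMeasure

instance : IsProbabilityMeasure coin := by unfold coin; infer_instance

/-- Independent fair coin flips. -/
def flips : Measure (ℕ → Bool) := Measure.infinitePi (fun _ : ℕ => coin)

instance : IsProbabilityMeasure flips := by unfold flips; infer_instance

/-- The base-4 digit, `0` or `2`, given by a coin flip. -/
def digit (b : Bool) : ℝ := if b then 2 else 0

/-- The point `∑ₖ bₖ 4^{-k}` (`k ≥ 1`, `bₖ ∈ {0, 2}`) of the Cantor set. -/
def cantorPoint (w : ℕ → Bool) : ℝ := ∑' k : ℕ, digit (w k) / 4 ^ (k + 1)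

/-- The invariant probability measure on the quarter Cantor set: the law of
`∑ₖ bₖ 4^{-k}` with independent digits `bₖ` uniform in `{0, 2}`. It is characterized by
`cantorMeasure_unique` below. -/
def cantorMeasure : Measure ℝ := flips.map cantorPoint

theorem digit_bound (b : Bool) (k : ℕ) : ‖digit b / 4 ^ (k + 1)‖ ≤ 2 * (1 / 4 : ℝ) ^ (k + 1) := by
  have h : |digit b| ≤ 2 := by cases b <;> simp [digit]
  rw [Real.norm_eq_abs, abs_div, abs_of_pos (by positivity : (0 : ℝ) < 4 ^ (k + 1)), one_div,
    inv_pow, ← div_eq_mul_inv]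
  gcongr

theorem summable_bound : Summable (fun k : ℕ => 2 * (1 / 4 : ℝ) ^ (k + 1)) :=
  ((summable_nat_add_iff 1).2
    (summable_geometric_of_lt_one (by norm_num) (by norm_num : (1 / 4 : ℝ) < 1))).mul_left 2

theorem summable_digit (w : ℕ → Bool) : Summable (fun k : ℕ => digit (w k) / 4 ^ (k + 1)) :=
  Summable.of_norm_bounded summable_bound (fun k => digit_bound (w k) k)

theorem measurable_cantorPoint : Measurable cantorPoint := by
  refine Continuous.measurable ?_
  refine continuous_tsum (fun k => ?_) summable_bound (fun k w => digit_bound (w k) k)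
  have h : Continuous digit := continuous_of_discreteTopology
  fun_prop

instance : IsProbabilityMeasure cantorMeasure :=
  Measure.isProbabilityMeasure_map measurable_cantorPoint.aemeasurable

/-- Prepend a coin flip. -/
def cons (b : Bool) (w : ℕ → Bool) : ℕ → Bool := fun n => Nat.casesOn n b w

theorem measurable_cons (b : Bool) : Measurable (cons b) := by
  refine measurable_pi_iff.2 (fun n => ?_)
  cases n with
  | zero => exact measurable_const
  | succ n => exact measurable_pi_apply n

theorem cantorPoint_cons (b : Bool) (w : ℕ → Bool) :
    cantorPoint (cons b w) = tau (digit b) (cantorPoint w) := by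
  unfold cantorPoint tau
  rw [(summable_digit (cons b w)).tsum_eq_zero_add, add_comm, add_div, ← tsum_div_const]
  congr 1
  · refine tsum_congr (fun k => ?_)
    simp only [cons]
    rw [div_div, pow_succ (4 : ℝ) (k + 1)]
  · simp [cons]

theorem coin_apply (t : Set Bool) :
    coin t = (1 / 2) * (t.indicator 1 false + t.indicator 1 true) := by
  classical
  rw [coin, PMF.toMeasure_apply_fintype]
  by_cases h1 : true ∈ t <;> by_cases h2 : false ∈ t <;>
    simp [h1, h2, mul_add]

theorem flips_eq :
    flips = (1 / 2 : ENNReal) • (flips.map (cons false) + flips.map (cons true)) := by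
  classical
  symm
  refine Measure.eq_infinitePi _ (fun s t ht => ?_)
  set s' : Finset ℕ := s.preimage Nat.succ (Nat.succ_injective.injOn) with hs'
  set t0 : Set Bool := if 0 ∈ s then t 0 else Set.univ with ht0
  have hm : MeasurableSet (Set.pi (s : Set ℕ) t) :=
    MeasurableSet.pi s.countable_toSet (fun i _ => ht i)
  have hpre : ∀ b, flips (cons b ⁻¹' (Set.pi (s : Set ℕ) t))
      = t0.indicator 1 b * ∏ i ∈ s', coin (t (i + 1)) := by
    intro b
    by_cases hb : b ∈ t0
    · have : cons b ⁻¹' (Set.pi (s : Set ℕ) t) = Set.pi (s' : Set ℕ) (fun i => t (i + 1)) := by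
        ext w
        simp only [Set.mem_preimage, Set.mem_pi, hs', Finset.coe_preimage, Finset.mem_coe]
        constructor
        · intro h i hi
          exact h (i + 1) hi
        · intro h i hi
          cases i with
          | zero => simpa [ht0, hi, cons] using hb
          | succ i => exact h i hi
      rw [this, flips, Measure.infinitePi_pi _ (fun i _ => ht (i + 1))]
      simp [hb]
    · have : cons b ⁻¹' (Set.pi (s : Set ℕ) t) = ∅ := by
        ext w
        simp only [Set.mem_preimage, Set.mem_pi, Set.mem_empty_iff_false, iff_false]
        intro h
        apply hb
        by_cases h0 : 0 ∈ s
        · simpa [ht0, h0, cons] using h 0 h0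
        · simp [ht0, h0]
      rw [this]
      simp [hb]
  have hprod : ∏ i ∈ s, coin (t i) = coin t0 * ∏ i ∈ s', coin (t (i + 1)) := by
    have h1 : ∏ i ∈ s', coin (t (i + 1)) = ∏ i ∈ s.erase 0, coin (t i) := by
      refine Finset.prod_bij (fun i _ => i + 1) ?_ ?_ ?_ ?_
      · intro i hi
        simpa [hs'] using hi
      · intro i _ j _ h
        simpa using h
      · intro j hj
        obtain ⟨hj0, hj⟩ := Finset.mem_erase.1 hj
        obtain ⟨i, rfl⟩ := Nat.exists_eq_succ_of_ne_zero hj0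
        exact ⟨i, by simpa [hs'] using hj, rfl⟩
      · intro i _
        rfl
    rw [h1]
    by_cases h0 : 0 ∈ s
    · rw [← Finset.mul_prod_erase s _ h0]
      simp [ht0, h0]
    · rw [Finset.erase_eq_of_notMem h0, ht0, if_neg h0, measure_univ, one_mul]
  rw [hprod, Measure.smul_apply, Measure.add_apply, Measure.map_apply (measurable_cons _) hm,
    Measure.map_apply (measurable_cons _) hm, hpre, hpre, coin_apply, smul_eq_mul, ← add_mul,
    mul_assoc]

theorem measurable_tau (d : ℝ) : Measurable (tau d) := by unfold tau; fun_prop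

/-- The measure solves the invariance equation. -/
theorem cantorMeasure_isInvariant : IsInvariant cantorMeasure := by
  intro E hE
  have hmap : ∀ b, (flips.map (cons b)) (cantorPoint ⁻¹' E)
      = cantorMeasure (tau (digit b) ⁻¹' E) := by
    intro b
    rw [Measure.map_apply (measurable_cons b) (measurable_cantorPoint hE), cantorMeasure,
      Measure.map_apply measurable_cantorPoint (measurable_tau _ hE)]
    congr 1
    ext w
    simp [cantorPoint_cons]
  rw [cantorMeasure, Measure.map_apply measurable_cantorPoint hE, flips_eq, Measure.smul_apply,
    Measure.add_apply, ← flips_eq, hmap, hmap, smul_eq_mul]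
  simp [digit, cantorMeasure]

theorem charFun_of_isInvariant {μ : Measure ℝ} [IsProbabilityMeasure μ] (h : IsInvariant μ) (t : ℝ) :
    charFun μ t = (1 + Complex.exp (t / 2 * Complex.I)) / 2 * charFun μ (t / 4) := by
  have hμ : μ = (1 / 2 : ENNReal) • (μ.map (tau 0) + μ.map (tau 2)) := by
    ext E hE
    rw [Measure.smul_apply, Measure.add_apply, Measure.map_apply (measurable_tau _) hE,
      Measure.map_apply (measurable_tau _) hE, smul_eq_mul]
    exact h E hE
  have hint : ∀ (ν : Measure ℝ) [IsProbabilityMeasure ν],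
      Integrable (fun x : ℝ => Complex.exp (t * x * Complex.I)) ν := by
    intro ν _
    refine Integrable.of_bound (C := 1) (by fun_prop) (Filter.Eventually.of_forall fun x => ?_)
    rw [← Complex.ofReal_mul, Complex.norm_exp_ofReal_mul_I]
  have hmap : ∀ d : ℝ, ∫ x, Complex.exp (t * x * Complex.I) ∂(μ.map (tau d))
      = Complex.exp (t * d / 4 * Complex.I) * charFun μ (t / 4) := by
    intro d
    rw [integral_map (measurable_tau d).aemeasurable (by fun_prop), charFun_apply_real,
      ← integral_const_mul]
    refine integral_congr_ae (Filter.Eventually.of_forall fun x => ?_)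
    simp only [tau]
    rw [← Complex.exp_add]
    congr 1
    push_cast
    ring
  have := fun d => Measure.isProbabilityMeasure_map (μ := μ) (measurable_tau d).aemeasurable
  rw [charFun_apply_real]
  conv_lhs => rw [hμ]
  rw [integral_smul_measure, integral_add_measure (hint _) (hint _), hmap, hmap]
  have h2 : (t : ℂ) * ((2 : ℝ) : ℂ) / 4 = t / 2 := by push_cast; ring
  rw [h2]
  simp
  ring

/-- The invariance equation has no other solution among the Borel probability measures. -/
theorem cantorMeasure_unique (μ : Measure ℝ) [IsProbabilityMeasure μ] (h : IsInvariant μ) :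
    μ = cantorMeasure := by
  refine Measure.ext_of_charFun (funext fun t => ?_)
  have key : ∀ n : ℕ, ∀ t : ℝ, ‖charFun μ t - charFun cantorMeasure t‖
      ≤ ‖charFun μ (t * (1 / 4) ^ n) - charFun cantorMeasure (t * (1 / 4) ^ n)‖ := by
    intro n
    induction n with
    | zero => intro t; simp
    | succ n ih =>
      intro t
      have hs : t * (1 / 4 : ℝ) ^ (n + 1) = t * (1 / 4) ^ n / 4 := by ring
      refine (ih t).trans ?_
      rw [hs, charFun_of_isInvariant h (t * (1 / 4) ^ n),
        charFun_of_isInvariant cantorMeasure_isInvariant (t * (1 / 4) ^ n),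
        ← mul_sub, norm_mul]
      refine mul_le_of_le_one_left (norm_nonneg _) ?_
      rw [norm_div, Complex.norm_ofNat, div_le_one (by norm_num)]
      refine (norm_add_le _ _).trans ?_
      have : ((t * (1 / 4) ^ n : ℝ) : ℂ) / 2 = ((t * (1 / 4) ^ n / 2 : ℝ) : ℂ) := by push_cast; ring
      rw [this, Complex.norm_exp_ofReal_mul_I]
      norm_num
  have hcont : ∀ (ν : Measure ℝ) [IsProbabilityMeasure ν], Continuous (charFun ν) := by
    intro ν _
    have : charFun ν = fun s : ℝ => ∫ x, Complex.exp (s * x * Complex.I) ∂ν :=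
      funext fun s => charFun_apply_real s
    rw [this]
    refine continuous_of_dominated (bound := fun _ => 1) (fun s => by fun_prop)
      (fun s => Filter.Eventually.of_forall fun x => ?_) (integrable_const _)
      (Filter.Eventually.of_forall fun x => by fun_prop)
    rw [← Complex.ofReal_mul, Complex.norm_exp_ofReal_mul_I]
  have hlim : Filter.Tendsto
      (fun n : ℕ => ‖charFun μ (t * (1 / 4) ^ n) - charFun cantorMeasure (t * (1 / 4) ^ n)‖)
      Filter.atTop (nhds 0) := by
    have h0 : Filter.Tendsto (fun n : ℕ => t * (1 / 4 : ℝ) ^ n) Filter.atTop (nhds 0) := by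
      simpa using (tendsto_pow_atTop_nhds_zero_of_lt_one (by norm_num)
        (by norm_num : (1 / 4 : ℝ) < 1)).const_mul t
    have h1 := ((((hcont μ).sub (hcont cantorMeasure)).norm).tendsto 0).comp h0
    simpa [Function.comp_def] using h1
  exact sub_eq_zero.1 (norm_le_zero_iff.1 (ge_of_tendsto' hlim fun n => key n t))

/-- The exponential `e_l(x) = e^{2π i l x}`. -/
def expFun (l x : ℝ) : ℂ := Complex.exp (2 * Real.pi * Complex.I * l * x)

theorem memLp_expFun (l : ℝ) (μ : Measure ℝ) [IsFiniteMeasure μ] : MemLp (expFun l) 2 μ := by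
  refine MemLp.of_bound (by unfold expFun; fun_prop) 1 (Filter.Eventually.of_forall fun x => ?_)
  have : (2 * Real.pi * Complex.I * l * x : ℂ) = ((2 * Real.pi * l * x : ℝ) : ℂ) * Complex.I := by
    push_cast
    ring
  rw [expFun, this, Complex.norm_exp_ofReal_mul_I]

/-- The exponential `e_l` as an element of `L²(μ)`. -/
def expLp (μ : Measure ℝ) [IsFiniteMeasure μ] (l : ℝ) : Lp ℂ 2 μ :=
  (memLp_expFun l μ).toLp (expFun l)

/-- `S` is a spectrum for `μ`: the family `(e_l)_{l ∈ S}` is an orthonormal (Hilbert) basis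
of `L²(μ)`. -/
def IsSpectrum (μ : Measure ℝ) [IsFiniteMeasure μ] (S : Set ℝ) : Prop :=
  ∃ b : HilbertBasis S ℂ (Lp ℂ 2 μ), ∀ l : S, b l = expLp μ l

/-- `Γ(m) = {∑_{k=0}^{n} 4^k l_k : l_k ∈ {0, m}, n ∈ ℕ}`. -/
def Gam (m : ℕ) : Set ℝ :=
  {x | ∃ (n : ℕ) (l : ℕ → ℝ), (∀ k, l k = 0 ∨ l k = m) ∧
    x = ∑ k ∈ Finset.range (n + 1), 4 ^ k * l k}

/-- The number `m` is complete: `Γ(m)` is a spectrum for the Cantor measure. (The notion is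
meant for odd `m`.) -/
def IsComplete (m : ℕ) : Prop := IsSpectrum cantorMeasure (Gam m)

/-- `o₄(m)`, for odd `m`: the smallest `a ≥ 1` with `4 ^ a ≡ 1` modulo `m`. -/
def o4 (m : ℕ) : ℕ := orderOf (4 : ZMod m)

/-- Simple primes. -/
def IsSimplePrime (p : ℕ) : Prop := p.Prime ∧ o4 p < o4 (p ^ 2)

end JPCantor

end

/-! Completeness of an odd `m` is governed by integer orbits: sequences of positive integers at most
`m / 3` obeying `x ↦ x / 4` or `x ↦ (x + m) / 4`. An orbit point `x 0` gives a unit vector `e_{-x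
0}` orthogonal to all exponentials of `Γ(m)` (`cantorFourier_orbit`). Conversely, the sum of `|μ̂(t
+ λ)|²` over `λ ∈ Γ(m)` is real analytic and a weighted average of its values at `t / 4` and `(t +
m) / 4`; if it is not identically `1`, its minimum set on `[0, m / 3]` is finite and produces an
orbit (`spectral_function_eq_one`).

Suppose the product in the theorem had an orbit. Dividing by `gcd (x 0) m` gives an orbit prime to a
divisor `m'` of `m`. If some `p i` does not divide `m'`, then (i) excludes the orbit. Otherwise `m'
= P * Q` with `P = ∏ p i`, and simplicity with (ii) makes the order of `4` modulo `m'` a multiple of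
`L * Q`, where `L` is the lcm in (iii). An orbit prime to `m'` has at least that many distinct
points. Counting those that agree modulo `P` forces `Q = 1` (`eq_one_of_mul_dvd_o4`); counting
base-four digits then bounds the order of `4` modulo `P` by the threshold in (iii)
(`o4_le_two_pow`), a contradiction. -/

noncomputable section

namespace JPCantor

/-! ### Scaling relation and zeros of the Fourier transform -/

/-- The Fourier transform of the Cantor measure. -/
def cantorFourier (s : ℝ) : ℂ := charFun cantorMeasure (2 * Real.pi * s)

theorem cantorFourier_eq (s : ℝ) :
    cantorFourier s = (1 + Complex.exp (Real.pi * s * Complex.I)) / 2 * cantorFourier (s / 4) := by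
  unfold cantorFourier
  rw [charFun_of_isInvariant cantorMeasure_isInvariant]
  congr 4
  · push_cast; ring_nf
  · ring

theorem cantorFourier_zero : cantorFourier 0 = 1 := by
  simp [cantorFourier]

theorem cantorFourier_odd (n : ℤ) : cantorFourier (2 * n + 1 : ℝ) = 0 := by
  rw [cantorFourier_eq]
  have : (Real.pi * ((2 * n + 1 : ℝ) : ℂ) * Complex.I) =
      Real.pi * Complex.I + n * (2 * Real.pi * Complex.I) := by push_cast; ring
  rw [this, Complex.exp_add, Complex.exp_int_mul_two_pi_mul_I, Complex.exp_pi_mul_I]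
  simp

theorem cantorFourier_of_odd {n : ℤ} (h : Odd n) : cantorFourier (n : ℝ) = 0 := by
  obtain ⟨k, rfl⟩ := h
  simpa using cantorFourier_odd k

theorem cantorFourier_four_mul (n : ℤ) :
    cantorFourier ((4 * n : ℤ) : ℝ) = cantorFourier (n : ℝ) := by
  rw [cantorFourier_eq]
  have : (Real.pi * (((4 * n : ℤ) : ℝ) : ℂ) * Complex.I) =
      ((2 * n : ℤ) : ℂ) * (2 * Real.pi * Complex.I) := by push_cast; ring
  rw [this, Complex.exp_int_mul_two_pi_mul_I]
  have h2 : ((4 * n : ℤ) : ℝ) / 4 = n := by push_cast; ring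
  rw [h2]
  norm_num

/-- The transition weight `|(1 + e^{πis}) / 2|²`. -/
def weight (s : ℝ) : ℝ := Real.cos (Real.pi * s / 2) ^ 2

theorem norm_sq_one_add_exp (x : ℝ) :
    ‖(1 + Complex.exp (x * Complex.I)) / 2‖ ^ 2 = Real.cos (x / 2) ^ 2 := by
  have : (1 + Complex.exp (x * Complex.I)) / 2
      = ((Real.cos (x / 2) : ℝ) : ℂ) * Complex.exp ((x / 2 : ℝ) * Complex.I) := by
    rw [Complex.ofReal_cos, Complex.cos, div_mul_eq_mul_div, add_mul, ← Complex.exp_add,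
      ← Complex.exp_add, add_comm]
    have h1 : ((x / 2 : ℝ) : ℂ) * Complex.I + ((x / 2 : ℝ) : ℂ) * Complex.I = x * Complex.I := by
      push_cast; ring
    have h2 : -((x / 2 : ℝ) : ℂ) * Complex.I + ((x / 2 : ℝ) : ℂ) * Complex.I = 0 := by ring
    rw [h1, h2, Complex.exp_zero]
  rw [this, norm_mul, Complex.norm_exp_ofReal_mul_I, mul_one, Complex.norm_real, Real.norm_eq_abs,
    sq_abs]

theorem norm_sq_cantorFourier (s : ℝ) :
    ‖cantorFourier s‖ ^ 2 = weight s * ‖cantorFourier (s / 4)‖ ^ 2 := by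
  rw [cantorFourier_eq, norm_mul, mul_pow]
  have : (Real.pi * (s : ℂ) * Complex.I) = ((Real.pi * s : ℝ) : ℂ) * Complex.I := by push_cast; ring
  rw [this, norm_sq_one_add_exp, weight]

theorem weight_nonneg (s : ℝ) : 0 ≤ weight s := sq_nonneg _

theorem weight_add_four_mul (s : ℝ) (n : ℕ) : weight (s + 4 * n) = weight s := by
  have : Real.pi * (s + 4 * n) / 2 = Real.pi * s / 2 + n * (2 * Real.pi) := by ring
  rw [weight, weight, this, Real.cos_add_nat_mul_two_pi]

theorem weight_add_odd (s : ℝ) {m : ℕ} (hm : Odd m) : weight s + weight (s + m) = 1 := by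
  obtain ⟨k, rfl⟩ := hm
  have : Real.pi * (s + (2 * k + 1 : ℕ)) / 2 = Real.pi * s / 2 + Real.pi / 2 + k * Real.pi := by
    push_cast; ring
  rw [weight, weight, this, Real.cos_add_nat_mul_pi, Real.cos_add_pi_div_two, mul_pow, ← pow_mul,
    mul_comm k 2, pow_mul, neg_one_sq, one_pow, one_mul, neg_sq]
  exact Real.cos_sq_add_sin_sq _

theorem exists_odd_of_weight_eq_zero {s : ℝ} (h : weight s = 0) : ∃ n : ℤ, s = 2 * n + 1 := by
  have h0 := pow_eq_zero_iff (two_ne_zero) |>.1 h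
  obtain ⟨k, hk⟩ := Real.cos_eq_zero_iff.1 h0
  refine ⟨k, ?_⟩
  have := Real.pi_ne_zero
  field_simp at hk
  linarith

/-! ### Enumeration of `Γ(m)` and orthonormality of its exponentials -/

/-- The `n`-th element of `Γ(m)`: the binary digits of `n` read in base four, times `m`. -/
def gam (m n : ℕ) : ℕ := m * Nat.ofDigits 4 (Nat.digits 2 n)

@[simp] theorem gam_zero (m : ℕ) : gam m 0 = 0 := by simp [gam]

theorem gam_two_mul (m n : ℕ) : gam m (2 * n) = 4 * gam m n := by
  rcases Nat.eq_zero_or_pos n with rfl | hn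
  · simp
  · rw [gam, gam, Nat.digits_base_mul one_lt_two hn, Nat.ofDigits_cons]
    ring

theorem gam_two_mul_add_one (m n : ℕ) : gam m (2 * n + 1) = m + 4 * gam m n := by
  rw [gam, gam, Nat.digits_def' one_lt_two (by omega), Nat.ofDigits_cons,
    show (2 * n + 1) % 2 = 1 by omega, show (2 * n + 1) / 2 = n by omega]
  ring

/-- Indexing by `ℕ` turns the lowest digit into the parity of the index, so that later sums and
inductions split into even and odd `n`. -/
theorem Gam_eq_range (m : ℕ) : Gam m = Set.range (fun n : ℕ => (gam m n : ℝ)) := by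
  ext x
  constructor
  · rintro ⟨n, l, hl, rfl⟩
    induction n generalizing l with
    | zero =>
      rcases hl 0 with h | h
      · exact ⟨0, by simp [h]⟩
      · exact ⟨1, by simpa [h] using gam_two_mul_add_one m 0⟩
    | succ n ih =>
      obtain ⟨k, hk⟩ := ih (fun i => l (i + 1)) (fun i => hl _)
      rw [Finset.sum_range_succ']
      have hs : ∑ i ∈ Finset.range (n + 1), (4 : ℝ) ^ (i + 1) * l (i + 1) = 4 * gam m k := by
        have hk' : (gam m k : ℝ) = _ := hk
        rw [hk', Finset.mul_sum]
        exact Finset.sum_congr rfl fun i _ => by ring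
      rcases hl 0 with h | h
      · exact ⟨2 * k, by simp only [gam_two_mul]; rw [hs, h]; push_cast; ring⟩
      · exact ⟨2 * k + 1, by simp only [gam_two_mul_add_one]; rw [hs, h]; push_cast; ring⟩
  · rintro ⟨n, rfl⟩
    induction n using Nat.strong_induction_on with
    | _ n ih =>
      rcases Nat.eq_zero_or_pos n with rfl | hn
      · exact ⟨0, fun _ => 0, fun _ => Or.inl rfl, by simp⟩
      · obtain ⟨N, l, hl, hx⟩ := ih (n / 2) (by omega)
        have hx' : (gam m (n / 2) : ℝ) = _ := hx
        have key : ∀ d : ℝ, (d = 0 ∨ d = m) → d + 4 * (gam m (n / 2) : ℝ) ∈ Gam m := by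
          intro d hd
          refine ⟨N + 1, fun i => Nat.casesOn i d l, ?_, ?_⟩
          · rintro (_ | i)
            · exact hd
            · exact hl i
          · rw [Finset.sum_range_succ', hx', Finset.mul_sum, add_comm]
            congr 1
            · exact Finset.sum_congr rfl fun i _ => by ring
            · simp
        rcases Nat.even_or_odd' n with ⟨k, rfl | rfl⟩
        · have := key 0 (Or.inl rfl)
          rw [show 2 * k / 2 = k by omega] at this
          simpa [gam_two_mul] using this
        · have := key m (Or.inr rfl)
          rw [show (2 * k + 1) / 2 = k by omega] at this
          simpa [gam_two_mul_add_one] using this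

/-- Equal lowest digits cancel, and the remaining factor `4` does not change the transform at an
integer. At the first digit where the indices differ, the difference is odd, and the transform
vanishes at odd integers. -/
theorem cantorFourier_gam_sub {m : ℕ} (hm : Odd m) {n k : ℕ} (h : n ≠ k) :
    cantorFourier (((gam m n : ℤ) - gam m k : ℤ) : ℝ) = 0 := by
  induction hN : n + k using Nat.strong_induction_on generalizing n k with
  | _ N ih =>
    rcases Nat.even_or_odd' n with ⟨a, rfl | rfl⟩ <;> rcases Nat.even_or_odd' k with ⟨b, rfl | rfl⟩
    · rw [gam_two_mul, gam_two_mul]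
      rw [show (((4 * gam m a : ℕ) : ℤ) - ((4 * gam m b : ℕ) : ℤ) : ℤ)
        = 4 * (gam m a - gam m b) by push_cast; ring, cantorFourier_four_mul]
      exact ih (a + b) (by omega) (by omega) rfl
    · apply cantorFourier_of_odd
      rw [gam_two_mul, gam_two_mul_add_one]
      obtain ⟨c, rfl⟩ := hm
      exact ⟨2 * gam _ a - 2 * gam _ b - c - 1, by push_cast; ring⟩
    · apply cantorFourier_of_odd
      rw [gam_two_mul, gam_two_mul_add_one]
      obtain ⟨c, rfl⟩ := hm
      exact ⟨2 * gam _ a - 2 * gam _ b + c, by push_cast; ring⟩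
    · rw [gam_two_mul_add_one, gam_two_mul_add_one]
      rw [show (((m + 4 * gam m a : ℕ) : ℤ) - ((m + 4 * gam m b : ℕ) : ℤ) : ℤ)
        = 4 * (gam m a - gam m b) by push_cast; ring, cantorFourier_four_mul]
      exact ih (a + b) (by omega) (by omega) rfl

theorem inner_expLp (a b : ℝ) :
    inner ℂ (expLp cantorMeasure a) (expLp cantorMeasure b) = cantorFourier (b - a) := by
  rw [L2.inner_def, cantorFourier, charFun_apply_real]
  refine integral_congr_ae ?_
  filter_upwards [(memLp_expFun a cantorMeasure).coeFn_toLp,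
    (memLp_expFun b cantorMeasure).coeFn_toLp] with x ha hb
  rw [expLp, expLp, ha, hb, RCLike.inner_apply, expFun, expFun, ← Complex.exp_conj,
    ← Complex.exp_add]
  congr 1
  simp [Complex.conj_ofNat]
  ring

theorem norm_expLp (a : ℝ) : ‖expLp cantorMeasure a‖ = 1 := by
  have h := inner_self_eq_norm_sq_to_K (𝕜 := ℂ) (expLp cantorMeasure a)
  rw [inner_expLp, sub_self, cantorFourier_zero] at h
  have h' : ‖expLp cantorMeasure a‖ ^ 2 = 1 := by
    exact Complex.ofReal_injective (by simpa using h.symm)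
  exact (pow_eq_one_iff_of_nonneg (norm_nonneg _) two_ne_zero).1 h'

theorem orthonormal_expLp_gam {m : ℕ} (hm : Odd m) :
    Orthonormal ℂ (fun n : ℕ => expLp cantorMeasure (gam m n)) := by
  refine ⟨fun n => norm_expLp _, fun n k h => ?_⟩
  change inner ℂ (expLp _ _) (expLp _ _) = 0
  rw [inner_expLp]
  simpa using cantorFourier_gam_sub hm h.symm

/-! ### Analytic dependence of the exponentials on the frequency -/

theorem cantorPoint_mem (w : ℕ → Bool) : cantorPoint w ∈ Set.Icc (0 : ℝ) 1 := by
  have h0 : ∀ b, 0 ≤ digit b := by intro b; cases b <;> simp [digit]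
  refine ⟨tsum_nonneg fun k => div_nonneg (h0 _) (by positivity), ?_⟩
  have hs : HasSum (fun k : ℕ => 2 * (1 / 4 : ℝ) ^ (k + 1)) (2 / 3) := by
    have := (hasSum_geometric_of_lt_one (by norm_num) (by norm_num : (1 / 4 : ℝ) < 1)).mul_left
      (1 / 2 : ℝ)
    have h1 : (fun k : ℕ => 2 * (1 / 4 : ℝ) ^ (k + 1)) = fun k => 1 / 2 * (1 / 4 : ℝ) ^ k :=
      funext fun k => by ring
    rw [h1]
    norm_num at this ⊢
    exact this
  refine ((summable_digit w).tsum_le_tsum (fun k => ?_) summable_bound).trans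
    (hs.tsum_eq.trans_le (by norm_num))
  exact (le_abs_self _).trans (digit_bound (w k) k)

theorem ae_mem_Icc_cantorMeasure : ∀ᵐ x ∂cantorMeasure, x ∈ Set.Icc (0 : ℝ) 1 :=
  (ae_map_iff measurable_cantorPoint.aemeasurable measurableSet_Icc).2
    (Filter.Eventually.of_forall cantorPoint_mem)

open scoped BoundedContinuousFunction ContDiff

/-- The function `x ↦ 2πix`, truncated to `[0, 1]`. -/
def clampedPhase : ℝ →ᵇ ℂ :=
  BoundedContinuousFunction.ofNormedAddCommGroup
    (fun x => 2 * Real.pi * Complex.I * ((max 0 (min x 1) : ℝ) : ℂ)) (by fun_prop) (2 * Real.pi)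
    (fun x => by
      rw [norm_mul, Complex.norm_real, Real.norm_eq_abs, abs_of_nonneg (le_max_left _ _)]
      have : max 0 (min x 1) ≤ 1 := max_le zero_le_one (min_le_right _ _)
      simpa [abs_of_pos Real.pi_pos] using mul_le_of_le_one_right (by positivity) this)

/-- Evaluation at a point is a continuous ring homomorphism, hence commutes with the exponential
series. -/
theorem exp_smul_clampedPhase_apply (t : ℝ) {x : ℝ} (hx : x ∈ Set.Icc (0 : ℝ) 1) :
    NormedSpace.exp (t • clampedPhase) x = expFun t x := by
  let ev : (ℝ →ᵇ ℂ) →+* ℂ :=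
    { toFun := fun f => f x
      map_one' := rfl
      map_mul' := fun _ _ => rfl
      map_zero' := rfl
      map_add' := fun _ _ => rfl }
  have hev : Continuous ev := continuous_eval_const x
  have h := NormedSpace.map_exp ev hev (t • clampedPhase)
  change NormedSpace.exp (t • clampedPhase) x = NormedSpace.exp ((t • clampedPhase) x) at h
  rw [h, ← Complex.exp_eq_exp_ℂ, expFun]
  congr 1
  simp [clampedPhase, max_eq_right hx.1, min_eq_left hx.2]
  ring

theorem expLp_eq_toLp (t : ℝ) : expLp cantorMeasure t
    = BoundedContinuousFunction.toLp 2 cantorMeasure ℝ (NormedSpace.exp (t • clampedPhase)) := by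
  apply Lp.ext
  filter_upwards [(memLp_expFun t cantorMeasure).coeFn_toLp,
    BoundedContinuousFunction.coeFn_toLp 2 cantorMeasure ℝ (NormedSpace.exp (t • clampedPhase)),
    ae_mem_Icc_cantorMeasure] with x h1 h2 hx
  rw [expLp, h1, h2, exp_smul_clampedPhase_apply t hx]

/-- The measure lives on `[0, 1]`, so the phase may be truncated to a bounded function. The curve is
then the exponential of a line in a Banach algebra, followed by a continuous linear map into `L²`.
-/
theorem contDiff_expLp : ContDiff ℝ ω (expLp cantorMeasure) := by
  have h : expLp cantorMeasure = fun t : ℝ => BoundedContinuousFunction.toLp 2 cantorMeasure ℝ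
      (NormedSpace.exp (t • clampedPhase)) := funext expLp_eq_toLp
  rw [h]
  have hexp : ContDiff ℝ ω (NormedSpace.exp : (ℝ →ᵇ ℂ) → (ℝ →ᵇ ℂ)) :=
    contDiff_omega_iff_analyticOnNhd.2 fun x _ => NormedSpace.exp_analytic x
  exact (ContinuousLinearMap.contDiff _).comp (hexp.comp (contDiff_id.smul contDiff_const))

end JPCantor

/-! ### Bessel's inequality and its equality case -/

section Bessel

variable {ι H : Type*} [NormedAddCommGroup H] [InnerProductSpace ℂ H] [CompleteSpace H]

/-- The coefficient map of an orthonormal family, as a contraction into `ℓ²`. -/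
theorem Orthonormal.exists_coefficientMap {v : ι → H} (hv : Orthonormal ℂ v) :
    ∃ T : H →L[ℂ] lp (fun _ : ι => ℂ) 2,
      (∀ x, HasSum (fun i => ‖inner ℂ (v i) x‖ ^ 2) (‖T x‖ ^ 2)) ∧ (∀ x, ‖T x‖ ≤ ‖x‖) ∧
      ∀ x f, ‖T x‖ = ‖x‖ → (∀ i, inner ℂ (v i) f = 0) → inner ℂ x f = 0 := by
  classical
  set V := hv.orthogonalFamily.linearIsometry with hV
  set T := V.toContinuousLinearMap.adjoint with hT
  have hcoef : ∀ x i, T x i = inner ℂ (v i) x := by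
    intro x i
    have h1 := lp.inner_single_left (𝕜 := ℂ) (G := fun _ : ι => ℂ) i (1 : ℂ) (T x)
    rw [hT, ContinuousLinearMap.adjoint_inner_right] at h1
    have h2 : V.toContinuousLinearMap (lp.single 2 i (1 : ℂ)) = v i := by
      simp [hV, OrthogonalFamily.linearIsometry_apply_single]
    rw [h2] at h1
    simpa using h1.symm
  have hle : ∀ x, ‖T x‖ ≤ ‖x‖ := by
    intro x
    refine (T.le_opNorm x).trans ?_
    refine mul_le_of_le_one_left (norm_nonneg _) ?_
    rw [hT, LinearIsometryEquiv.norm_map]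
    exact V.norm_toContinuousLinearMap_le
  refine ⟨T, fun x => ?_, hle, fun x f hx hf => ?_⟩
  · have := lp.hasSum_norm (p := 2) (by norm_num) (T x)
    simpa [hcoef] using this
  · have hf0 : T f = 0 := by
      ext i
      simp [hcoef, hf]
    have hxV : V (T x) = x := by
      have h1 : ‖V (T x) - x‖ ^ 2 = 0 := by
        rw [norm_sub_sq (𝕜 := ℂ), V.norm_map]
        have h2 : inner ℂ (V (T x)) x = inner ℂ (T x) (T x) := by
          rw [hT, ContinuousLinearMap.adjoint_inner_right]
          rfl
        rw [h2, inner_self_eq_norm_sq, hx]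
        ring
      exact sub_eq_zero.1 (norm_eq_zero.1 (pow_eq_zero_iff two_ne_zero |>.1 h1))
    have : inner ℂ (T x) (T f) = inner ℂ (V (T x)) f := by
      conv_lhs => rw [hT, ContinuousLinearMap.adjoint_inner_right]
      rfl
    rw [← hxV, ← this, hf0, inner_zero_right]

end Bessel

end

noncomputable section

namespace JPCantor

open scoped ContDiff

/-! ### The spectral function of `Γ(m)` and its averaging equation -/

theorem norm_cantorFourier_neg (s : ℝ) : ‖cantorFourier (-s)‖ = ‖cantorFourier s‖ := by
  rw [cantorFourier, mul_neg, charFun_neg, RCLike.norm_conj, cantorFourier]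

/-- The function `t ↦ ∑_{λ ∈ Γ(m)} |μ̂(t + λ)|²` is real analytic and at most `1`, and it is `1`
exactly where `e_{-t}` lies in the closed span of the exponentials of `Γ(m)`. -/
theorem exists_spectral_function {m : ℕ} (hm : Odd m) :
    ∃ h : ℝ → ℝ, ContDiff ℝ ω h ∧
      (∀ t : ℝ, HasSum (fun n : ℕ => ‖cantorFourier (t + gam m n)‖ ^ 2) (h t)) ∧
      (∀ t, h t ≤ 1) ∧
      ∀ (t : ℝ) (f : Lp ℂ 2 cantorMeasure), h t = 1 →
        (∀ n : ℕ, inner ℂ (expLp cantorMeasure (gam m n)) f = 0) →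
        inner ℂ (expLp cantorMeasure (-t)) f = 0 := by
  obtain ⟨T, hsum, hle, horth⟩ := (orthonormal_expLp_gam hm).exists_coefficientMap
  refine ⟨fun t => ‖T (expLp cantorMeasure (-t))‖ ^ 2, ?_, fun t => ?_, fun t => ?_,
    fun t f ht hf => horth _ f ?_ hf⟩
  · exact ((T.restrictScalars ℝ).contDiff.comp (contDiff_expLp.comp contDiff_neg)).norm_sq ℂ
  · convert hsum (expLp cantorMeasure (-t)) using 3 with n
    rw [inner_expLp, ← norm_cantorFourier_neg]
    congr 2
    ring
  · refine pow_le_one₀ (norm_nonneg _) ((hle _).trans_eq (norm_expLp _))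
  · rw [norm_expLp]
    exact (pow_eq_one_iff_of_nonneg (norm_nonneg _) two_ne_zero).1 ht

/-- The sum splits by the lowest digit. One scaling step in each half pulls out a weight that is
constant over the half, by 4-periodicity. -/
theorem spectral_function_eq {m : ℕ} {h : ℝ → ℝ}
    (hsum : ∀ t : ℝ, HasSum (fun n : ℕ => ‖cantorFourier (t + gam m n)‖ ^ 2) (h t)) (t : ℝ) :
    h t = weight t * h (t / 4) + weight (t + m) * h ((t + m) / 4) := by
  refine (hsum t).unique (HasSum.even_add_odd ?_ ?_)
  · have e : (fun n : ℕ => ‖cantorFourier (t + gam m (2 * n))‖ ^ 2)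
        = fun n => weight t * ‖cantorFourier (t / 4 + gam m n)‖ ^ 2 := by
      ext n
      rw [norm_sq_cantorFourier, gam_two_mul]
      push_cast
      rw [weight_add_four_mul]
      congr 4
      ring
    rw [e]
    exact (hsum (t / 4)).mul_left _
  · have e : (fun n : ℕ => ‖cantorFourier (t + gam m (2 * n + 1))‖ ^ 2)
        = fun n => weight (t + m) * ‖cantorFourier ((t + m) / 4 + gam m n)‖ ^ 2 := by
      ext n
      rw [norm_sq_cantorFourier, gam_two_mul_add_one]
      push_cast
      rw [← add_assoc, weight_add_four_mul]
      congr 4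
      ring
    rw [e]
    exact (hsum ((t + m) / 4)).mul_left _

/-! ### Integer orbits as the obstruction to completeness -/

/-- An infinite path of positive integers in `[0, m / 3]` under the maps `x ↦ (x + l) / 4`,
`l ∈ {0, m}`. -/
def IsIntegerOrbit (m : ℕ) (x : ℕ → ℕ) : Prop :=
  ∀ i, 0 < x i ∧ 3 * x i ≤ m ∧ (4 * x (i + 1) = x i ∨ 4 * x (i + 1) = x i + m)

/-- Some sequence is an integer orbit. -/
def HasIntegerOrbit (m : ℕ) : Prop := ∃ x, IsIntegerOrbit m x

theorem eq_const_of_infinite_fiber {h : ℝ → ℝ} (hω : ContDiff ℝ ω h) {a b c : ℝ}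
    (hinf : {t ∈ Set.Icc a b | h t = c}.Infinite) : h = fun _ => c := by
  obtain ⟨z, -, hz⟩ := hinf.exists_accPt_of_subset_isCompact isCompact_Icc fun t ht => ht.1
  refine AnalyticOnNhd.eq_of_frequently_eq (z₀ := z) hω.analyticOnNhd
    (contDiff_const (n := ω)).analyticOnNhd ?_
  exact (accPt_iff_frequently_nhdsNE.1 hz).mono fun t ht => ht.2

theorem exists_nat_of_weight_eq_zero {m : ℕ} {x : ℝ} (hx : 0 ≤ x)
    (h : weight x = 0 ∨ weight (x + m) = 0) : ∃ n : ℕ, x = n := by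
  have hz : ∃ k : ℤ, x = k := by
    rcases h with h | h
    · obtain ⟨k, hk⟩ := exists_odd_of_weight_eq_zero h
      exact ⟨2 * k + 1, by push_cast; exact hk⟩
    · obtain ⟨k, hk⟩ := exists_odd_of_weight_eq_zero h
      exact ⟨2 * k + 1 - m, by push_cast; linarith⟩
  obtain ⟨k, rfl⟩ := hz
  lift k to ℕ using by exact_mod_cast hx
  exact ⟨k, by simp⟩

/-- A finite set on which the allowed transitions never leave consists of integers. -/
theorem hasIntegerOrbit_of_finite {m : ℕ} (hm : Odd m) {M : Set ℝ} (hfin : M.Finite)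
    (hne : M.Nonempty) (hMI : M ⊆ Set.Icc 0 (m / 3 : ℝ)) (h0 : (0 : ℝ) ∉ M)
    (hzero : ∀ x ∈ M, weight x ≠ 0 → x / 4 ∈ M)
    (hone : ∀ x ∈ M, weight (x + m) ≠ 0 → (x + m) / 4 ∈ M) : HasIntegerOrbit m := by
  have hm0 : (0 : ℝ) < m := by exact_mod_cast hm.pos
  have hsucc : ∀ x : M, ∃ y : M, 4 * (y : ℝ) = x ∨ 4 * (y : ℝ) = x + m := by
    intro x
    by_cases hw : weight (x : ℝ) = 0
    · have hw' : weight ((x : ℝ) + m) ≠ 0 := by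
        intro hw'
        have := weight_add_odd (x : ℝ) hm
        rw [hw, hw'] at this
        norm_num at this
      exact ⟨⟨_, hone x x.2 hw'⟩, Or.inr (by simp; ring)⟩
    · exact ⟨⟨_, hzero x x.2 hw⟩, Or.inl (by simp; ring)⟩
  choose s hs using hsucc
  -- The two maps send `[0, m / 3]` to the disjoint intervals `[0, m / 12]` and `[m / 4, m / 3]`, so
  -- predecessors are unique.
  have hpred : ∀ x x' : M, ∀ y : ℝ, (4 * y = x ∨ 4 * y = x + m) → (4 * y = x' ∨ 4 * y = x' + m) →
      x = x' := by
    intro x x' y h1 h2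
    have := hMI x.2
    have := hMI x'.2
    simp only [Set.mem_Icc] at *
    apply Subtype.ext
    rcases h1 with h1 | h1 <;> rcases h2 with h2 | h2 <;> linarith
  have hinj : Function.Injective s := fun x x' h =>
    hpred x x' (s x) (hs x) (by rw [h]; exact hs x')
  have : Finite M := hfin
  have hsurj : Function.Surjective s := Finite.surjective_of_injective hinj
  -- If both weights at `x` were nonzero, both images of `x` would lie in `M` and be values of the
  -- bijection `s`. Their only predecessor is `x`, so they would coincide. Hence a weight vanishes,
  -- which happens only at integers.
  have hint : ∀ x : M, ∃ n : ℕ, (x : ℝ) = n := by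
    intro x
    refine exists_nat_of_weight_eq_zero (m := m) (hMI x.2).1 ?_
    by_contra! hw
    obtain ⟨x₁, h1⟩ := hsurj ⟨_, hzero x x.2 hw.1⟩
    obtain ⟨x₂, h2⟩ := hsurj ⟨_, hone x x.2 hw.2⟩
    have e1 : x₁ = x := hpred x₁ x (s x₁) (hs x₁) (Or.inl (by rw [h1]; simp; ring))
    have e2 : x₂ = x := hpred x₂ x (s x₂) (hs x₂) (Or.inr (by rw [h2]; simp; ring))
    rw [e1] at h1
    rw [e2, h1] at h2
    have := Subtype.ext_iff.1 h2
    simp only at this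
    linarith
  choose N hN using hint
  obtain ⟨x₀, hx₀⟩ := hne
  refine ⟨fun i => N (s^[i] ⟨x₀, hx₀⟩), fun i => ⟨?_, ?_, ?_⟩⟩
  · refine Nat.pos_of_ne_zero fun h => h0 ?_
    have := hN (s^[i] ⟨x₀, hx₀⟩)
    rw [show N (s^[i] ⟨x₀, hx₀⟩) = 0 from h, Nat.cast_zero] at this
    exact this ▸ Subtype.coe_prop _
  · have := (hMI (s^[i] ⟨x₀, hx₀⟩).2).2
    rw [hN] at this
    have h3 : (3 : ℝ) * (N (s^[i] ⟨x₀, hx₀⟩)) ≤ m := by linarith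
    exact_mod_cast h3
  · have := hs (s^[i] ⟨x₀, hx₀⟩)
    simp only [Function.iterate_succ_apply']
    rw [hN, hN] at this
    exact_mod_cast this

/-- Minimum principle: where an average with weights summing to `1` attains the minimum, so does
every term of nonzero weight. The minimum set on `[0, m / 3]` is therefore closed under allowed
transitions. By analyticity it is finite unless `h` is constant, and it omits `0` because `h 0 = 1`.
-/
theorem spectral_function_eq_one {m : ℕ} (hm : Odd m) {h : ℝ → ℝ} (hω : ContDiff ℝ ω h)
    (hsum : ∀ t : ℝ, HasSum (fun n : ℕ => ‖cantorFourier (t + gam m n)‖ ^ 2) (h t))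
    (hle : ∀ t, h t ≤ 1) (horb : ¬ HasIntegerOrbit m) (t : ℝ) : h t = 1 := by
  have hm0 : (0 : ℝ) < m := by exact_mod_cast hm.pos
  have h0 : h 0 = 1 := by
    refine le_antisymm (hle 0) ?_
    have := le_hasSum (hsum 0) 0 fun n _ => by positivity
    simpa [cantorFourier_zero] using this
  by_contra hne
  have hfin : ∀ c, {t ∈ Set.Icc (0 : ℝ) (m / 3) | h t = c}.Finite := by
    intro c
    by_contra hinf
    have hc := eq_const_of_infinite_fiber hω hinf
    rw [hc] at h0 hne
    exact hne h0
  obtain ⟨t₀, ht₀, hmin⟩ := isCompact_Icc.exists_isMinOn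
    (Set.nonempty_Icc.2 (by positivity : (0 : ℝ) ≤ m / 3)) hω.continuous.continuousOn
  have hmin' : ∀ t ∈ Set.Icc (0 : ℝ) (m / 3), h t₀ ≤ h t := fun t ht => hmin ht
  have hlt : h t₀ < 1 := by
    refine lt_of_le_of_ne (hle _) fun h1 => ?_
    refine (Set.Icc_infinite (by positivity : (0 : ℝ) < m / 3)) ((hfin 1).subset fun t ht => ?_)
    exact ⟨ht, le_antisymm (hle t) (h1 ▸ hmin' t ht)⟩
  have hstep : ∀ x ∈ Set.Icc (0 : ℝ) (m / 3), x / 4 ∈ Set.Icc (0 : ℝ) (m / 3) ∧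
      (x + m) / 4 ∈ Set.Icc (0 : ℝ) (m / 3) := by
    intro x hx
    simp only [Set.mem_Icc] at *
    refine ⟨⟨?_, ?_⟩, ?_, ?_⟩ <;> linarith
  refine horb (hasIntegerOrbit_of_finite hm (hfin (h t₀)) ⟨t₀, ht₀, rfl⟩ (fun x hx => hx.1)
    (fun hx => ?_) (fun x hx hw => ⟨(hstep x hx.1).1, ?_⟩) fun x hx hw => ⟨(hstep x hx.1).2, ?_⟩)
  · exact hlt.ne (hx.2.symm.trans h0)
  all_goals
    have hfe := spectral_function_eq hsum x
    have hw1 := weight_add_odd x hm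
    have ha := hmin' _ (hstep x hx.1).1
    have hb := hmin' _ (hstep x hx.1).2
    rw [hx.2] at hfe
    have hwx := weight_nonneg x
    have hwy := weight_nonneg (x + m)
    have e : weight x * (h (x / 4) - h t₀) + weight (x + m) * (h ((x + m) / 4) - h t₀) = 0 := by
      linear_combination -hfe - h t₀ * hw1
    have e1 := mul_nonneg hwx (sub_nonneg.2 ha)
    have e2 := mul_nonneg hwy (sub_nonneg.2 hb)
  · have := (mul_eq_zero.1 (le_antisymm (by linarith) e1)).resolve_left hw
    linarith
  · have := (mul_eq_zero.1 (le_antisymm (by linarith) e2)).resolve_left hw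
    linarith

/-- Every exponential lies in the closed span of those of `Γ(m)`. Completeness of `1` is what makes
the exponentials total in `L²(μ)`. -/
theorem isComplete_of_not_hasIntegerOrbit {m : ℕ} (hm : Odd m) (h1 : IsComplete 1)
    (horb : ¬ HasIntegerOrbit m) : IsComplete m := by
  obtain ⟨h, hω, hsum, hle, horth⟩ := exists_spectral_function hm
  have hone := spectral_function_eq_one hm hω hsum hle horb
  set v : Gam m → Lp ℂ 2 cantorMeasure := fun l => expLp cantorMeasure l with hv
  have hmem : ∀ n : ℕ, (gam m n : ℝ) ∈ Gam m := fun n => by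
    rw [Gam_eq_range]
    exact ⟨n, rfl⟩
  have hvo : Orthonormal ℂ v := by
    refine ⟨fun l => norm_expLp _, ?_⟩
    rintro ⟨a, ha⟩ ⟨b, hb⟩ hab
    rw [Gam_eq_range] at ha hb
    obtain ⟨i, rfl⟩ := ha
    obtain ⟨j, rfl⟩ := hb
    exact (orthonormal_expLp_gam hm).2 fun hij => hab (by simp [hij])
  have hbot : (Submodule.span ℂ (Set.range v))ᗮ = ⊥ := by
    refine (Submodule.eq_bot_iff _).2 fun f hf => ?_
    have hf' : ∀ n : ℕ, inner ℂ (expLp cantorMeasure (gam m n)) f = 0 := fun n =>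
      (Submodule.mem_orthogonal _ _).1 hf _ (Submodule.subset_span ⟨⟨_, hmem n⟩, rfl⟩)
    obtain ⟨b, hb⟩ := h1
    have hz : b.repr f = 0 := by
      ext l
      rw [b.repr_apply_apply, hb, ← neg_neg (l : ℝ), horth _ f (hone _) hf']
      rfl
    simpa using hz
  exact ⟨HilbertBasis.mkOfOrthogonalEqBot hvo hbot, fun l => by
    rw [HilbertBasis.coe_mkOfOrthogonalEqBot]⟩

/-- If the lowest digit of `n` agrees with the orbit's branch at `x i`, the sum is four times the
sum for the next orbit point and `n / 2`; otherwise it is odd. The descent ends: `n` decreases until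
it is `0`, and after that the positive orbit point does. -/
theorem cantorFourier_orbit {m : ℕ} (hm : Odd m) {x : ℕ → ℕ}
    (hx : IsIntegerOrbit m x) (n i : ℕ) :
    cantorFourier ((x i + gam m n : ℤ) : ℝ) = 0 := by
  obtain ⟨c, hc⟩ := hm
  induction n using Nat.strong_induction_on generalizing i with
  | _ n ihn =>
    induction hX : x i using Nat.strong_induction_on generalizing i with
    | _ X ihX =>
      subst hX
      obtain ⟨hpos, -, hi⟩ := hx i
      rcases Nat.even_or_odd' n with ⟨a, rfl | rfl⟩
      · rw [gam_two_mul]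
        rcases hi with hi | hi
        · rw [← hi, show (((4 * x (i + 1) : ℕ) : ℤ) + ((4 * gam m a : ℕ) : ℤ) : ℤ)
            = 4 * (x (i + 1) + gam m a) by push_cast; ring, cantorFourier_four_mul]
          rcases Nat.eq_zero_or_pos a with rfl | ha
          · exact ihX _ (by omega) (i + 1) rfl
          · exact ihn a (by omega) (i + 1)
        · apply cantorFourier_of_odd
          exact ⟨2 * x (i + 1) - c - 1 + 2 * gam m a, by push_cast; omega⟩
      · rw [gam_two_mul_add_one]
        rcases hi with hi | hi
        · apply cantorFourier_of_odd
          exact ⟨2 * x (i + 1) + c + 2 * gam m a, by push_cast; omega⟩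
        · rw [show ((x i : ℤ) + ((m + 4 * gam m a : ℕ) : ℤ) : ℤ) = 4 * (x (i + 1) + gam m a) by
            push_cast; omega, cantorFourier_four_mul]
          exact ihn a (by omega) (i + 1)

theorem not_isComplete_of_hasIntegerOrbit {m : ℕ} (hm : Odd m) (horb : HasIntegerOrbit m) :
    ¬ IsComplete m := by
  rintro ⟨b, hb⟩
  obtain ⟨x, hx⟩ := horb
  have hz : b.repr (expLp cantorMeasure (-(x 0 : ℝ))) = 0 := by
    ext l
    obtain ⟨n, hn⟩ : (l : ℝ) ∈ Set.range (fun n : ℕ => (gam m n : ℝ)) := Gam_eq_range m ▸ l.2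
    have h0 : ‖cantorFourier (-(x 0 : ℝ) - gam m n)‖ = 0 := by
      rw [← norm_cantorFourier_neg, norm_eq_zero]
      convert cantorFourier_orbit hm hx n 0 using 2
      push_cast
      ring
    rw [b.repr_apply_apply, hb, ← hn, inner_expLp, norm_eq_zero.1 h0]
    rfl
  have h1 := norm_expLp (-(x 0 : ℝ))
  rw [← b.repr.norm_map, hz, norm_zero] at h1
  exact zero_ne_one h1

/-! ### Counting points of an integer orbit -/

namespace IsIntegerOrbit

/-- The binary digits of `w` record the branches taken in `n` steps. -/
theorem exists_gam {m : ℕ} {x : ℕ → ℕ} (hx : IsIntegerOrbit m x) (n i : ℕ) :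
    ∃ w < 2 ^ n, 4 ^ n * x (i + n) = x i + gam m w := by
  induction n generalizing i with
  | zero => exact ⟨0, by simp⟩
  | succ n ih =>
    obtain ⟨w, hw, h⟩ := ih (i + 1)
    have e : 4 ^ (n + 1) * x (i + (n + 1)) = 4 * (x (i + 1) + gam m w) := by
      rw [← h, show i + (n + 1) = i + 1 + n by omega]
      ring
    have hp : 2 ^ (n + 1) = 2 * 2 ^ n := by ring
    rcases (hx i).2.2 with hi | hi
    · exact ⟨2 * w, by omega, by rw [e, gam_two_mul]; omega⟩
    · exact ⟨2 * w + 1, by omega, by rw [e, gam_two_mul_add_one]; omega⟩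

theorem pow_mul_modEq {m : ℕ} {x : ℕ → ℕ} (hx : IsIntegerOrbit m x) (n i : ℕ) :
    4 ^ n * x (i + n) ≡ x i [MOD m] := by
  obtain ⟨w, -, h⟩ := hx.exists_gam n i
  rw [h, gam]
  simp [Nat.ModEq]

/-- Modulo `m` a step is division by `4`, so a point prime to `m` can recur only after a multiple of
the order of `4`. -/
theorem o4_dvd_sub {m : ℕ} {x : ℕ → ℕ} (hx : IsIntegerOrbit m x)
    (hc : Nat.Coprime (x 0) m) {i j : ℕ} (hij : i ≤ j) (h : x i = x j) : o4 m ∣ j - i := by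
  have h1 := hx.pow_mul_modEq i 0
  have h2 := hx.pow_mul_modEq j 0
  rw [zero_add] at h1 h2
  have h3 : x 0 * 4 ^ (j - i) ≡ x 0 * 1 [MOD m] := by
    calc x 0 * 4 ^ (j - i) ≡ 4 ^ i * x i * 4 ^ (j - i) [MOD m] := (h1.symm).mul_right _
      _ = 4 ^ j * x j := by
        rw [h, mul_right_comm, ← pow_add, Nat.add_sub_cancel' hij]
      _ ≡ x 0 * 1 [MOD m] := by rw [mul_one]; exact h2
  have h4 : 4 ^ (j - i) ≡ 1 [MOD m] := Nat.ModEq.cancel_left_of_coprime hc.symm h3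
  refine orderOf_dvd_of_pow_eq_one ?_
  have := (ZMod.natCast_eq_natCast_iff _ _ _).2 h4
  simpa using this

theorem eq_of_lt_o4 {m : ℕ} {x : ℕ → ℕ} (hx : IsIntegerOrbit m x)
    (hc : Nat.Coprime (x 0) m) {i j n : ℕ} (hi : i < o4 m) (hj : j < o4 m)
    (h : x (i + n) = x (j + n)) : i = j := by
  rcases le_total i j with hij | hij
  · have := Nat.eq_zero_of_dvd_of_lt (hx.o4_dvd_sub hc (by omega) h) (by omega)
    omega
  · have := Nat.eq_zero_of_dvd_of_lt (hx.o4_dvd_sub hc (by omega) h.symm) (by omega)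
    omega

/-- Points of `[0, m / 3]` in the orbit are separated by their first `n` digits. -/
theorem o4_le_two_pow {m : ℕ} {x : ℕ → ℕ} (hx : IsIntegerOrbit m x)
    (hc : Nat.Coprime (x 0) m) {n : ℕ} (hn : m < 3 * 4 ^ n) : o4 m ≤ 2 ^ n := by
  choose w hw h using hx.exists_gam n
  have := Finset.card_le_card_of_injOn (s := Finset.range (o4 m)) (t := Finset.range (2 ^ n)) w
    (fun i _ => by simpa using hw i) (by
      intro i hi j hj hij
      simp only [Finset.coe_range, Set.mem_Iio] at hi hj
      refine hx.eq_of_lt_o4 hc (n := n) hi hj ?_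
      -- Equal digits give `4 ^ n * |x (i + n) - x (j + n)| = |x i - x j| ≤ m / 3 < 4 ^ n`, so the
      -- points after `n` steps coincide.
      have h1 := h i
      have h2 := h j
      rw [hij] at h1
      have b1 := (hx i).2.1
      have b2 := (hx j).2.1
      have hpos : 0 < 4 ^ n := by positivity
      by_contra hne
      rcases lt_or_gt_of_ne hne with hlt | hlt
      · have := Nat.mul_le_mul_left (4 ^ n) (Nat.succ_le_of_lt hlt)
        rw [Nat.succ_eq_add_one, mul_add, mul_one] at this
        omega
      · have := Nat.mul_le_mul_left (4 ^ n) (Nat.succ_le_of_lt hlt)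
        rw [Nat.succ_eq_add_one, mul_add, mul_one] at this
        omega)
  simpa using this

/-- If the order of `4` modulo `P * Q` is a multiple of `L * Q`, where `4 ^ L ≡ 1` modulo `P`, then
`Q` points of the orbit agree modulo `P`, which is too many for `Q > 1`. -/
theorem eq_one_of_mul_dvd_o4 {P Q L : ℕ} (hm : Odd (P * Q)) {x : ℕ → ℕ}
    (hx : IsIntegerOrbit (P * Q) x) (hc : Nat.Coprime (x 0) (P * Q)) (hL : 4 ^ L ≡ 1 [MOD P])
    (hL0 : 0 < L) (hdvd : L * Q ∣ o4 (P * Q)) : Q = 1 := by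
  have hQ0 : 0 < Q := Nat.pos_of_ne_zero (by rintro rfl; simp at hm)
  have hP0 : 0 < P := Nat.pos_of_ne_zero (by rintro rfl; simp at hm)
  have hmod : ∀ i, x (L * i) ≡ x 0 [MOD P] := by
    intro i
    have h1 := (hx.pow_mul_modEq (L * i) 0).of_dvd (Dvd.intro _ rfl : P ∣ P * Q)
    rw [zero_add, pow_mul] at h1
    have h2 := ((hL.pow i).mul_right (x (L * i))).symm
    rw [one_pow, one_mul] at h2
    exact h2.trans h1
  have hinj : ∀ i j, i ≤ j → j < Q → x (L * i) = x (L * j) → i = j := by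
    intro i j hij hj h
    have h1 := hdvd.trans (hx.o4_dvd_sub hc (Nat.mul_le_mul_left L hij) h)
    rw [← Nat.mul_sub] at h1
    have := Nat.eq_zero_of_dvd_of_lt (Nat.dvd_of_mul_dvd_mul_left hL0 h1) (by omega)
    omega
  -- The `Q` points `x (L * i)` share a residue modulo `P`, so their quotients by `P` are distinct.
  -- These are at most `Q / 3`, and `Q ≤ Q / 3 + 1` leaves only `Q = 1`.
  have hcard := Finset.card_le_card_of_injOn (s := Finset.range Q)
    (t := Finset.range (Q / 3 + 1)) (fun i => x (L * i) / P)
    (fun i _ => by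
      simp only [Finset.coe_range, Set.mem_Iio]
      have := (hx (L * i)).2.1
      rw [Nat.lt_succ_iff, Nat.le_div_iff_mul_le (by norm_num)]
      refine Nat.le_of_mul_le_mul_left ?_ hP0
      have h2 := Nat.mul_div_le (x (L * i)) P
      calc P * (x (L * i) / P * 3) = 3 * (P * (x (L * i) / P)) := by ring
        _ ≤ P * Q := by omega) (by
      intro i hi j hj hij
      simp only [Finset.coe_range, Set.mem_Iio] at hi hj hij
      have h1 : x (L * i) = x (L * j) := by
        rw [← Nat.div_add_mod (x (L * i)) P, ← Nat.div_add_mod (x (L * j)) P, hij,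
          (hmod i).trans (hmod j).symm]
      rcases le_total i j with h | h
      · exact hinj i j h hj h1
      · exact (hinj j i h hi h1.symm).symm)
  simp only [Finset.card_range] at hcard
  omega

/-- The gcd of `x 0` and `m` is odd, so it survives division by `4` and divides the whole orbit;
dividing it out keeps all the orbit conditions. -/
theorem exists_coprime {m : ℕ} (hm : Odd m) {x : ℕ → ℕ} (hx : IsIntegerOrbit m x) :
    ∃ m', m' ∣ m ∧ ∃ y, IsIntegerOrbit m' y ∧ Nat.Coprime (y 0) m' := by
  set d := Nat.gcd (x 0) m with hd
  have hd0 : 0 < d := Nat.gcd_pos_of_pos_left _ (hx 0).1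
  have hdm : d ∣ m := Nat.gcd_dvd_right _ _
  have hd4 : Nat.Coprime d 4 :=
    Nat.Coprime.pow_right 2 (Nat.Coprime.coprime_dvd_left hdm hm.coprime_two_right)
  have hdx : ∀ i, d ∣ x i := by
    intro i
    induction i with
    | zero => exact Nat.gcd_dvd_left _ _
    | succ i ih =>
      refine hd4.dvd_of_dvd_mul_left ?_
      rcases (hx i).2.2 with h | h
      · rw [h]; exact ih
      · rw [h]; exact dvd_add ih hdm
  choose y hy using hdx
  obtain ⟨m', hm'⟩ := hdm
  refine ⟨m', ⟨d, by rw [hm']; ring⟩, y, fun i => ?_, ?_⟩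
  · obtain ⟨h1, h2, h3⟩ := hx i
    rw [hm', hy i] at h2
    rw [hm', hy i, hy (i + 1)] at h3
    rw [hy i] at h1
    refine ⟨Nat.pos_of_mul_pos_left h1, ?_, ?_⟩
    · refine Nat.le_of_mul_le_mul_left ?_ hd0
      linarith
    · refine h3.imp (fun h => ?_) (fun h => ?_) <;> refine Nat.eq_of_mul_eq_mul_left hd0 ?_ <;>
        linarith
  · have h : Nat.gcd (d * y 0) (d * m') = d := by rw [← hy 0, ← hm']
    rw [Nat.gcd_mul_left] at h
    exact Nat.eq_of_mul_eq_mul_left hd0 (by rw [h, mul_one])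

end IsIntegerOrbit

/-! ### The order of `4` modulo products of simple primes -/

theorem o4_dvd_of_dvd {a b : ℕ} (h : a ∣ b) : o4 a ∣ o4 b := by
  have := orderOf_map_dvd (ZMod.castHom h (ZMod a)).toMonoidHom (4 : ZMod b)
  have e : (ZMod.castHom h (ZMod a)).toMonoidHom (4 : ZMod b) = 4 :=
    map_ofNat (ZMod.castHom h (ZMod a)) 4
  rwa [e] at this

theorem o4_pos {m : ℕ} (hm : Odd m) : 0 < o4 m := by
  have h := Nat.ModEq.pow_totient
    (Nat.Coprime.pow_left 2 hm.coprime_two_left : Nat.Coprime (2 ^ 2) m)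
  rw [← ZMod.natCast_eq_natCast_iff] at h
  refine orderOf_pos_iff.2 (isOfFinOrder_iff_pow_eq_one.2
    ⟨m.totient, Nat.totient_pos.2 hm.pos, ?_⟩)
  norm_num at h
  exact h

/-- Simplicity says that `4 ^ o4 p = 1 + p * a` with `p ∤ a`, and such an element has order exactly
`p ^ k` modulo `p ^ (k + 1)`. -/
theorem IsSimplePrime.pow_dvd_o4 {p : ℕ} (hp : IsSimplePrime p) (h3 : 3 < p) (k : ℕ) :
    p ^ k ∣ o4 (p ^ (k + 1)) := by
  have h1 : (p : ℤ) ∣ 4 ^ o4 p - 1 := by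
    rw [← ZMod.intCast_zmod_eq_zero_iff_dvd]
    have : (4 : ZMod p) ^ o4 p = 1 := pow_orderOf_eq_one _
    push_cast
    rw [this, sub_self]
  obtain ⟨a, ha⟩ := h1
  have hna : ¬ (p : ℤ) ∣ a := by
    rintro ⟨b, rfl⟩
    have h2 : (4 : ZMod (p ^ 2)) ^ o4 p = 1 := by
      have : (((4 ^ o4 p - 1 : ℤ)) : ZMod (p ^ 2)) = 0 := by
        rw [ZMod.intCast_zmod_eq_zero_iff_dvd, ha]
        exact ⟨b, by push_cast; ring⟩
      push_cast at this
      exact sub_eq_zero.1 this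
    have := Nat.le_of_dvd (o4_pos (hp.1.odd_of_ne_two (by omega))) (orderOf_dvd_of_pow_eq_one h2)
    exact absurd hp.2 (not_lt.2 this)
  have h := ZMod.orderOf_one_add_mul_prime hp.1 (by omega) a hna k
  have e : (1 + p * a : ZMod (p ^ (k + 1))) = 4 ^ o4 p := by
    have : (4 ^ o4 p : ℤ) = 1 + p * a := by linarith
    have := congrArg (Int.cast : ℤ → ZMod (p ^ (k + 1))) this
    push_cast at this
    exact this.symm
  rw [← h, e]
  exact orderOf_pow_dvd _

theorem exists_eq_prod_pow_of_dvd {ι : Type*} {p : ι → ℕ} (hp : ∀ i, (p i).Prime) (k : ι → ℕ)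
    (s : Finset ι) {m : ℕ} (h : m ∣ ∏ i ∈ s, p i ^ k i) : ∃ j : ι → ℕ, m = ∏ i ∈ s, p i ^ j i := by
  classical
  induction s using Finset.induction_on generalizing m with
  | empty => exact ⟨0, by simpa using h⟩
  | insert a s ha ih =>
    rw [Finset.prod_insert ha] at h
    obtain ⟨u, v, hu, hv, rfl⟩ := exists_dvd_and_dvd_of_dvd_mul h
    obtain ⟨e, -, rfl⟩ := (Nat.dvd_prime_pow (hp a)).1 hu
    obtain ⟨j, rfl⟩ := ih hv
    refine ⟨Function.update j a e, ?_⟩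
    rw [Finset.prod_insert ha, Function.update_self]
    congr 1
    refine Finset.prod_congr rfl fun i hi => ?_
    rw [Function.update_of_ne (ne_of_mem_of_not_mem hi ha)]

section SimplePrimes

variable {r : ℕ} {p : Fin r → ℕ}

theorem four_pow_lcm_modEq (hp_inj : Function.Injective p) (hp : ∀ i, (p i).Prime) :
    4 ^ (Finset.univ.lcm fun i => o4 (p i)) ≡ 1 [MOD ∏ i, p i] := by
  refine (Nat.modEq_iff_dvd' (Nat.one_le_pow _ _ (by norm_num))).2 ?_ |>.symm
  refine Finset.prod_dvd_of_isRelPrime (fun i _ j _ hij => ?_) fun i _ => ?_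
  · exact Nat.coprime_iff_isRelPrime.1 ((Nat.coprime_primes (hp i) (hp j)).2 (hp_inj.ne hij))
  · refine (Nat.modEq_iff_dvd' (Nat.one_le_pow _ _ (by norm_num))).1 ?_
    rw [← ZMod.natCast_eq_natCast_iff]
    obtain ⟨c, hc⟩ := Finset.dvd_lcm (f := fun i => o4 (p i)) (Finset.mem_univ i)
    rw [hc, pow_mul]
    have : (4 : ZMod (p i)) ^ o4 (p i) = 1 := pow_orderOf_eq_one _
    push_cast
    rw [this, one_pow]

/-- Each factor divides the order separately; `h_ndvd` makes the two coprime, so their product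
divides it too. -/
theorem lcm_mul_prod_dvd_o4 (hp_inj : Function.Injective p) (hp : ∀ i, IsSimplePrime (p i))
    (hp_gt : ∀ i, 3 < p i) (h_ndvd : ∀ i j, ¬ p j ∣ o4 (p i)) (k : Fin r → ℕ) :
    (Finset.univ.lcm fun i => o4 (p i)) * ∏ i, p i ^ k i ∣ o4 ((∏ i, p i) * ∏ i, p i ^ k i) := by
  have hdvd : ∀ i, p i ^ (k i + 1) ∣ (∏ i, p i) * ∏ i, p i ^ k i := by
    intro i
    rw [← Finset.prod_mul_distrib, pow_succ']
    exact Finset.dvd_prod_of_mem (fun i => p i * p i ^ k i) (Finset.mem_univ i)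
  refine Nat.Coprime.mul_dvd_of_dvd_of_dvd ?_ ?_ ?_
  · refine Nat.Coprime.prod_right fun i _ => Nat.Coprime.pow_right _ ?_
    refine Nat.Coprime.symm ((hp i).1.coprime_iff_not_dvd.2 fun h => ?_)
    have h' : p i ∣ ∏ j, o4 (p j) :=
      h.trans (Finset.lcm_dvd fun j hj => Finset.dvd_prod_of_mem (fun j => o4 (p j)) hj)
    obtain ⟨j, -, hj⟩ := (hp i).1.prime.exists_mem_finset_dvd h'
    exact h_ndvd j i hj
  · exact Finset.lcm_dvd fun i _ => o4_dvd_of_dvd ((dvd_pow_self _ (Nat.succ_ne_zero _)).trans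
      (hdvd i))
  · refine Finset.prod_dvd_of_isRelPrime (fun i _ j _ hij => ?_) fun i _ => ?_
    · exact Nat.coprime_iff_isRelPrime.1
        (((Nat.coprime_primes (hp i).1 (hp j).1).2 (hp_inj.ne hij)).pow _ _)
    · exact ((hp i).pow_dvd_o4 (hp_gt i) (k i)).trans (o4_dvd_of_dvd (hdvd i))

theorem odd_prod_pow (hp : ∀ i, (p i).Prime) (hp_gt : ∀ i, 3 < p i) (s : Finset (Fin r))
    (k : Fin r → ℕ) : Odd (∏ i ∈ s, p i ^ k i) := by
  rw [← Nat.coprime_two_left, Nat.coprime_prod_right_iff]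
  exact fun i _ => Nat.Coprime.pow_right _ (Nat.coprime_two_left.2
    ((hp i).odd_of_ne_two (by have := hp_gt i; omega)))

/-- The real threshold of the orbit count, as a natural power of two. -/
theorem exists_two_pow_threshold {P : ℕ} (hP : 3 ≤ P) :
    ∃ n : ℕ, (2 : ℝ) ^ ⌈Real.logb 2 (Real.sqrt ((P : ℝ) / 3))⌉ = 2 ^ n ∧ P ≤ 3 * 4 ^ n := by
  have hP' : (3 : ℝ) ≤ P := by exact_mod_cast hP
  have h1 : 1 ≤ Real.sqrt ((P : ℝ) / 3) := Real.one_le_sqrt.2 (by linarith)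
  set z := Real.logb 2 (Real.sqrt ((P : ℝ) / 3)) with hz
  have hz0 : 0 ≤ z := Real.logb_nonneg (by norm_num) h1
  lift ⌈z⌉ to ℕ using Int.ceil_nonneg hz0 with n hn
  refine ⟨n, by simp, ?_⟩
  have hzn : z ≤ n := by
    have := Int.le_ceil z
    rw [← hn] at this
    exact_mod_cast this
  rw [hz, Real.logb_le_iff_le_rpow (by norm_num) (by linarith), Real.rpow_natCast] at hzn
  have h2 := (Real.sqrt_le_left (by positivity)).1 hzn
  rw [← pow_mul, mul_comm n 2, pow_mul] at h2
  have h3 : (P : ℝ) ≤ 3 * 4 ^ n := by norm_num at h2; linarith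
  exact_mod_cast h3

/-- There is no orbit prime to a product in which all the primes occur. -/
theorem not_isIntegerOrbit_of_coprime (hp_inj : Function.Injective p)
    (hp : ∀ i, IsSimplePrime (p i)) (hp_gt : ∀ i, 3 < p i) (h_ndvd : ∀ i j, ¬ p j ∣ o4 (p i))
    (h_lcm : (2 : ℝ) ^ ⌈Real.logb 2 (Real.sqrt (((∏ i, p i : ℕ) : ℝ) / 3))⌉ <
      ((Finset.univ.lcm (fun i => o4 (p i)) : ℕ) : ℝ)) (k : Fin r → ℕ) {x : ℕ → ℕ}
    (hx : IsIntegerOrbit ((∏ i, p i) * ∏ i, p i ^ k i) x)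
    (hc : Nat.Coprime (x 0) ((∏ i, p i) * ∏ i, p i ^ k i)) : False := by
  have hodd : Odd ((∏ i, p i) * ∏ i, p i ^ k i) := by
    have := odd_prod_pow (fun i => (hp i).1) hp_gt Finset.univ (fun i => 1 + k i)
    simpa [pow_add, Finset.prod_mul_distrib] using this
  have hL0 : 0 < Finset.univ.lcm (fun i => o4 (p i)) := by
    have : (0 : ℝ) < ((Finset.univ.lcm (fun i => o4 (p i)) : ℕ) : ℝ) :=
      lt_trans (by positivity) h_lcm
    exact_mod_cast this
  have hdvd := lcm_mul_prod_dvd_o4 hp_inj hp hp_gt h_ndvd k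
  have hQ := hx.eq_one_of_mul_dvd_o4 hodd hc (four_pow_lcm_modEq hp_inj fun i => (hp i).1) hL0 hdvd
  rw [hQ, mul_one] at hx hc hodd hdvd
  rw [mul_one] at hdvd
  have hP3 : 3 ≤ ∏ i, p i := by
    have := hx 0
    omega
  obtain ⟨n, hn, hPn⟩ := exists_two_pow_threshold hP3
  -- The digit count needs a strict inequality, while the ceiling gives only `≤`. Equality would
  -- make `3` one of the primes.
  have hne : ∏ i, p i ≠ 3 * 4 ^ n := by
    intro h
    have h3 : 3 ∣ ∏ i, p i := ⟨_, h⟩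
    obtain ⟨i, -, hi⟩ := Nat.prime_three.prime.exists_mem_finset_dvd h3
    have := (Nat.prime_dvd_prime_iff_eq Nat.prime_three (hp i).1).1 hi
    have := hp_gt i
    omega
  have hle := hx.o4_le_two_pow hc (lt_of_le_of_ne hPn hne)
  have hle' := (Nat.le_of_dvd (o4_pos hodd) hdvd).trans hle
  rw [hn] at h_lcm
  have : 2 ^ n < Finset.univ.lcm (fun i => o4 (p i)) := by exact_mod_cast h_lcm
  omega

end SimplePrimes

end JPCantor

end

/-! ### Reduction to an orbit prime to its modulus -/

theorem corollary3p14 (r : ℕ) (p : Fin r → ℕ) (hp_inj : Function.Injective p)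
    (hp_simple : ∀ i, JPCantor.IsSimplePrime (p i)) (hp_gt : ∀ i, 3 < p i)
    (h_proper : ∀ F : Finset (Fin r), F ⊂ Finset.univ → ∀ k : Fin r → ℕ,
      JPCantor.IsComplete (∏ i ∈ F, p i ^ k i))
    (h_ndvd : ∀ i j, ¬ p j ∣ JPCantor.o4 (p i))
    (h_lcm : (2 : ℝ) ^ ⌈Real.logb 2 (Real.sqrt (((∏ i, p i : ℕ) : ℝ) / 3))⌉ <
      ((Finset.univ.lcm (fun i => JPCantor.o4 (p i)) : ℕ) : ℝ)) :
    ∀ k : Fin r → ℕ, JPCantor.IsComplete (∏ i, p i ^ k i) := by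
  intro k
  have hp : ∀ i, (p i).Prime := fun i => (hp_simple i).1
  have hodd := JPCantor.odd_prod_pow hp hp_gt
  -- For `r = 0` the lcm is `1`, while `√(1/3) > 1/2` makes the threshold at least `1`, against
  -- `h_lcm`. Hence `∅` is a proper subset, and it supplies completeness of `1`.
  have hne : (Finset.univ : Finset (Fin r)).Nonempty := by
    rw [Finset.nonempty_iff_ne_empty]
    intro he
    refine absurd h_lcm (not_lt.2 ?_)
    have hz : 0 ≤ ⌈Real.logb 2 (Real.sqrt (1 / 3))⌉ := by
      rw [Int.le_ceil_iff, Real.lt_logb_iff_rpow_lt (by norm_num) (by positivity)]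
      rw [show ((0 : ℤ) : ℝ) - 1 = -1 by norm_num, Real.rpow_neg_one]
      exact Real.lt_sqrt_of_sq_lt (by norm_num)
    simpa [he] using one_le_zpow₀ (one_le_two (α := ℝ)) hz
  have h1 : JPCantor.IsComplete 1 := by
    simpa using h_proper ∅ (Finset.empty_ssubset.2 hne) 0
  refine JPCantor.isComplete_of_not_hasIntegerOrbit (hodd Finset.univ k) h1 ?_
  rintro ⟨x, hx⟩
  obtain ⟨m', hm', y, hy, hc⟩ :=
    JPCantor.IsIntegerOrbit.exists_coprime (hodd Finset.univ k) hx
  obtain ⟨j, rfl⟩ := JPCantor.exists_eq_prod_pow_of_dvd hp k Finset.univ hm'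
  -- A vanishing exponent puts `m'` among the products over a proper subset, which are complete and
  -- so have no orbit.
  by_cases hj : ∃ i, j i = 0
  · obtain ⟨i, hi⟩ := hj
    have e : ∏ i, p i ^ j i = ∏ i ∈ Finset.univ.erase i, p i ^ j i := by
      rw [← Finset.mul_prod_erase Finset.univ _ (Finset.mem_univ i), hi, pow_zero, one_mul]
    rw [e] at hy
    exact JPCantor.not_isComplete_of_hasIntegerOrbit (hodd _ j) ⟨y, hy⟩
      (h_proper _ (Finset.erase_ssubset (Finset.mem_univ i)) j)
  · push Not at hj
    have e : ∏ i, p i ^ j i = (∏ i, p i) * ∏ i, p i ^ (j i - 1) := by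
      rw [← Finset.prod_mul_distrib]
      exact Finset.prod_congr rfl fun i _ => by
        rw [← pow_succ', Nat.sub_add_cancel (Nat.one_le_iff_ne_zero.2 (hj i))]
    rw [e] at hy hc
    exact JPCantor.not_isIntegerOrbit_of_coprime hp_inj hp_simple hp_gt h_ndvd h_lcm _ hy hc
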